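/- Let $n \ge 1$ and $0 \le m \le n$ be integers and write $[n]=\{1,\dots,n\}$. Let $D$ be a digraph with vertex set $[n]$ (loops allowed) and let $s=(s_1,\dots,s_m)\in[n]^m$. The drivers $1,\dots,m$ enter one after the other. Driver $i$ starts at the vertex $s_i$. If her current vertex is unoccupied, she parks there; if it is occupied, she chooses an out-neighbour of it, drives there, and repeats. The sequence $s$ is called a parking function on $D$ if it is possible (for some choices of the drivers) that all $m$ drivers park. Let $P(D,m)$ be the number of $s\in[n]^m$ that are parking functions on $D$. Let $\widetilde{\mathcal T}_n$ be the set of source trees on $[n]$, that is, of rooted trees with vertex set $[n]$ in which every edge is directed away from the root. For $f:[n]\to[n]$, the inverse mapping digraph $\widetilde M_f$ is the digraph with vertex set $[n]$ and edge set $\{(f(i),i): i\in[n]\}$; let $\widetilde{\mathcal M}_n$ be the set of the digraphs $\widetilde M_f$ for all $f:[n]\to[n]$. Put \[ \widetilde F_{n,m}=\sum_{T\in\widetilde{\mathcal T}_n}P(T,m),\qquad \widetilde M_{n,m}=\sum_{M\in\widetilde{\mathcal M}_n}P(M,m). \] Then \[ n\cdot\widetilde F_{n,m}=\widetilde M_{n,m}.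 \] -/

import Mathlib

namespace DigraphParking

/-- `ParksAt D occ v x`: a driver currently at vertex `v`, on the digraph `D` whose set of occupied
vertices is `occ`, can end up parking at `x`.  At an unoccupied vertex she parks at once; at an
occupied one she chooses an out-neighbour, drives there and repeats. -/
inductive ParksAt {V : Type*} (D : Digraph V) (occ : Set V) : V → V → Prop
  | park {v : V} (hv : v ∉ occ) : ParksAt D occ v v
  | drive {v w x : V} (hv : v ∈ occ) (hvw : D.Adj v w) (hw : ParksAt D occ w x) :
      ParksAt D occ v x

/-- `s` is a parking function on `D`: the `m` drivers, entering one after the other, can all park.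
Here `p i` is the vertex where driver `i` parks, so that the vertices occupied when driver `i`
enters are the `p j` with `j < i`. -/
def IsParkingFunction {V : Type*} (D : Digraph V) {m : ℕ} (s : Fin m → V) : Prop :=
  ∃ p : Fin m → V, ∀ i : Fin m, ParksAt D {x | ∃ j : Fin m, j < i ∧ p j = x} (s i) (p i)

/-- `P(D, m)`: the number of sequences of length `m` that are parking functions on `D`. -/
noncomputable def numParking {n : ℕ} (D : Digraph (Fin n)) (m : ℕ) : ℕ :=
  Nat.card {s : Fin m → Fin n // IsParkingFunction D s}

/-- A source tree: a rooted tree with all edges oriented away from the root.  The root has no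
incoming edge, every other vertex has exactly one (from its parent), and every vertex can be
reached from the root by a directed path. -/
def IsSourceTree {V : Type*} (D : Digraph V) : Prop :=
  ∃ r : V, (∀ u, ¬ D.Adj u r) ∧ (∀ v, v ≠ r → ∃! u, D.Adj u v) ∧
    ∀ v, Relation.ReflTransGen D.Adj r v

/-- The inverse mapping digraph of `f`, with the edges `(f i, i)`. -/
def inverseMappingDigraph {V : Type*} (f : V → V) : Digraph V where
  Adj u v := u = f v

/-- The set of all source trees with vertex set `Fin n`. -/
def sourceTrees (n : ℕ) : Set (Digraph (Fin n)) := {D | IsSourceTree D}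

/-- The set of all inverse mapping digraphs with vertex set `Fin n`. -/
def inverseMappings (n : ℕ) : Set (Digraph (Fin n)) := Set.range inverseMappingDigraph

open Classical in
/-- The number of pairs of a source tree on `Fin n` and a parking function of length `m` on it. -/
noncomputable def sourceTreeTotal (n m : ℕ) : ℕ :=
  ∑ D : Digraph (Fin n) with D ∈ sourceTrees n, numParking D m

open Classical in
/-- The number of pairs of an inverse mapping digraph on `Fin n` and a parking function of
length `m` on it. -/
noncomputable def inverseMappingTotal (n m : ℕ) : ℕ :=
  ∑ D : Digraph (Fin n) with D ∈ inverseMappings n, numParking D m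

end DigraphParking

/-! On a digraph where every vertex has at most one parent, Hall's theorem turns parking into a
weight condition. Give a vertex the weight one minus the number of drivers who start there; then all
drivers can park exactly when, for every vertex, the set of vertices reachable from it has
nonnegative weight (`isParkingFunction_iff_isGood`). Both totals are therefore sums over `s` of
numbers of parent maps that are good for this weight, and the identity holds for each `s` separately
(`card_mul_ncard_good_trees`), indeed for any integer weight.

The factor `n` marks a vertex of the tree, and the comparison refines Joyal's count. Cutting a
function at its periodic points leaves a rooted forest and a permutation of its roots; cutting a
marked tree along the path from the mark to the root leaves a forest and a linear ordering of its
roots. Fix the forest and give each root the weight of its whole tree. Sets of descendants of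
non-roots are not affected by how the roots are joined. At the roots, goodness says that all prefix
sums of the ordering, respectively all cycle sums of the permutation, are nonnegative
(`isGood_glue_next_iff`, `isGood_glue_perm_iff`).

Spitzer's lemma (`ncard_orderings_eq_ncard_perms`) says that these orderings and permutations are
equally many. -/

namespace DigraphParking

open Finset Equiv

/-! ### Spitzer's lemma: prefix sums of orderings and cycle sums of permutations -/

section Spitzer

variable {V : Type*}

/-- The linear orderings of a finite set, as lists. -/
def orderings [DecidableEq V] (S : Finset V) : Set (List V) := {l | l.Nodup ∧ l.toFinset = S}

/-- The permutations that fix everything outside of `S`. -/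
def permsOn (S : Finset V) : Set (Perm V) := {σ | ∀ x, x ∉ S → σ x = x}

/-- The sum of a weight over the cycle of `x`. -/
noncomputable def cycleSum [Fintype V] (c : V → ℤ) (σ : Perm V) (x : V) : ℤ :=
  open Classical in ∑ y with σ.SameCycle x y, c y

/-- The orderings of `S` all of whose prefixes have nonnegative weight. -/
def nonnegOrderings [DecidableEq V] (c : V → ℤ) (S : Finset V) : Set (List V) :=
  {l | l ∈ orderings S ∧ ∀ u, u <+: l → 0 ≤ (u.map c).sum}

/-- The orderings of `S` all of whose nonempty suffixes have negative weight. -/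
def negOrderings [DecidableEq V] (c : V → ℤ) (S : Finset V) : Set (List V) :=
  {l | l ∈ orderings S ∧ ∀ u, u <:+ l → u ≠ [] → (u.map c).sum < 0}

/-- The permutations of `S` all of whose cycles have nonnegative weight. -/
def nonnegPerms [Fintype V] (c : V → ℤ) (S : Finset V) : Set (Perm V) :=
  {σ | σ ∈ permsOn S ∧ ∀ x ∈ S, 0 ≤ cycleSum c σ x}

/-- The permutations of `S` all of whose cycles have negative weight. -/
def negPerms [Fintype V] (c : V → ℤ) (S : Finset V) : Set (Perm V) :=
  {σ | σ ∈ permsOn S ∧ ∀ x ∈ S, cycleSum c σ x < 0}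

lemma orderings_eq [DecidableEq V] (S : Finset V) :
    orderings S = ↑S.toList.permutations.toFinset := by
  ext l
  simp only [orderings, Set.mem_ofPred_eq, mem_coe, List.mem_toFinset, List.mem_permutations]
  constructor
  · rintro ⟨h, rfl⟩
    exact (List.perm_of_nodup_nodup_toFinset_eq h (Finset.nodup_toList _) (by simp))
  · intro h
    exact ⟨h.nodup_iff.2 S.nodup_toList, by rw [List.toFinset_eq_of_perm _ _ h]; simp⟩

lemma finite_orderings [DecidableEq V] (S : Finset V) : (orderings S).Finite := by
  rw [orderings_eq]; exact Finset.finite_toSet _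

lemma ncard_orderings [DecidableEq V] (S : Finset V) : (orderings S).ncard = S.card.factorial := by
  rw [orderings_eq, Set.ncard_coe_finset, List.toFinset_card_of_nodup
    (List.nodup_permutations _ S.nodup_toList), List.length_permutations, Finset.length_toList]

lemma ncard_permsOn [Fintype V] [DecidableEq V] (S : Finset V) :
    (permsOn S).ncard = S.card.factorial := by
  have := Nat.card_congr (Perm.subtypeEquivSubtypePerm (fun x => x ∈ S))
  rw [Nat.card_perm] at this
  rw [Nat.card_eq_fintype_card, Fintype.card_coe] at this
  exact this.symm

lemma sum_map_of_mem_orderings [DecidableEq V] (c : V → ℤ) {S : Finset V} {l : List V}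
    (h : l ∈ orderings S) :
    (l.map c).sum = ∑ x ∈ S, c x := by
  rw [← h.2, List.sum_toFinset _ h.1]

/-- Every list splits at the first minimum of its partial sums. -/
lemma exists_split (c : V → ℤ) (l : List V) : ∃ u v, l = u ++ v ∧
    (∀ t, t <:+ u → t ≠ [] → (t.map c).sum < 0) ∧ ∀ t, t <+: v → 0 ≤ (t.map c).sum := by
  induction l with
  | nil => exact ⟨[], [], rfl, by simp, by simp⟩
  | cons a l ih =>
    obtain ⟨u, v, rfl, hu, hv⟩ := ih
    by_cases h : c a + (u.map c).sum < 0
    · refine ⟨a :: u, v, rfl, ?_, hv⟩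
      intro t ht ht'
      rcases List.suffix_cons_iff.1 ht with rfl | ht
      · simpa using h
      · exact hu t ht ht'
    · refine ⟨[], a :: (u ++ v), rfl, by simp, ?_⟩
      intro t ht
      rcases List.prefix_cons_iff.1 ht with rfl | ⟨t, rfl, ht'⟩
      · simp
      rcases List.prefix_or_prefix_of_prefix ht' (List.prefix_append u v) with ⟨w, rfl⟩ | ⟨w, rfl⟩
      · have : (w.map c).sum ≤ 0 := by
          by_cases hw : w = []
          · simp [hw]
          · exact (hu w (List.suffix_append _ _) hw).le
        simp at h ⊢
        linarith
      · have := hv w ((List.prefix_append_right_inj _).1 ht')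
        simp at h ⊢
        linarith

/-- If the two cuts differed, the segment between them would be a nonempty suffix of one left part
and a prefix of the other right part, hence both negative and nonnegative. -/
lemma split_unique (c : V → ℤ) {u v u' v' : List V} (h : u ++ v = u' ++ v')
    (hu : ∀ t, t <:+ u → t ≠ [] → (t.map c).sum < 0) (hv : ∀ t, t <+: v → 0 ≤ (t.map c).sum)
    (hu' : ∀ t, t <:+ u' → t ≠ [] → (t.map c).sum < 0)
    (hv' : ∀ t, t <+: v' → 0 ≤ (t.map c).sum) : u = u' ∧ v = v' := by
  rcases List.append_eq_append_iff.1 h with ⟨t, rfl, rfl⟩ | ⟨t, rfl, rfl⟩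
  · by_cases ht : t = []
    · simp [ht]
    · exact absurd (hu' t (List.suffix_append _ _) ht) (hv t (List.prefix_append _ _)).not_gt
  · by_cases ht : t = []
    · simp [ht]
    · exact absurd (hu t (List.suffix_append _ _) ht) (hv' t (List.prefix_append _ _)).not_gt

lemma ncard_orderings_eq_sum [Fintype V] [DecidableEq V] (c : V → ℤ) (S : Finset V) :
    (orderings S).ncard =
    ∑ U ∈ S.powerset, (negOrderings c U).ncard * (nonnegOrderings c (S \ U)).ncard := by
  have hN (U : Finset V) : (negOrderings c U).Finite :=
    (finite_orderings U).subset fun l hl => hl.1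
  have hA (U : Finset V) : (nonnegOrderings c U).Finite :=
    (finite_orderings U).subset fun l hl => hl.1
  have h : (finite_orderings S).toFinset.card =
      (S.powerset.sigma fun U => (hN U).toFinset ×ˢ (hA (S \ U)).toFinset).card := by
    symm
    refine Finset.card_bij (fun a _ => a.2.1 ++ a.2.2) ?_ ?_ ?_
    · rintro ⟨U, u, v⟩ h
      simp only [mem_sigma, mem_powerset, mem_product, Set.Finite.mem_toFinset] at h ⊢
      obtain ⟨hU, hu, hv⟩ := h
      refine ⟨?_, ?_⟩
      · rw [List.nodup_append']
        refine ⟨hu.1.1, hv.1.1, ?_⟩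
        rw [← List.disjoint_toFinset_iff_disjoint, hu.1.2, hv.1.2]
        exact disjoint_sdiff
      · rw [List.toFinset_append, hu.1.2, hv.1.2]
        exact union_sdiff_of_subset hU
    · rintro ⟨U, u, v⟩ h ⟨U', u', v'⟩ h' e
      simp only [mem_sigma, mem_powerset, mem_product, Set.Finite.mem_toFinset] at h h' e
      obtain ⟨rfl, rfl⟩ := split_unique c e h.2.1.2 h.2.2.2 h'.2.1.2 h'.2.2.2
      obtain rfl : U = U' := by rw [← h.2.1.1.2, ← h'.2.1.1.2]
      rfl
    · intro l hl
      rw [Set.Finite.mem_toFinset] at hl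
      obtain ⟨u, v, rfl, hu, hv⟩ := exists_split c l
      obtain ⟨h1, h2⟩ := hl
      rw [List.nodup_append'] at h1
      rw [List.toFinset_append] at h2
      refine ⟨⟨u.toFinset, u, v⟩, ?_, rfl⟩
      simp only [mem_sigma, mem_powerset, mem_product, Set.Finite.mem_toFinset]
      refine ⟨h2 ▸ subset_union_left, ⟨⟨h1.1, rfl⟩, hu⟩, ⟨⟨h1.2.1, ?_⟩, hv⟩⟩
      rw [← h2, union_sdiff_left, sdiff_eq_self_of_disjoint]
      exact (List.disjoint_toFinset_iff_disjoint.2 h1.2.2).symm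
  rw [Set.ncard_eq_toFinset_card _ (finite_orderings S), h, card_sigma]
  refine Finset.sum_congr rfl fun U _ => ?_
  rw [card_product, Set.ncard_eq_toFinset_card _ (hN U), Set.ncard_eq_toFinset_card _ (hA _)]

lemma permsOn_disjoint {U W : Finset V} (h : Disjoint U W) {τ ρ : Perm V} (hτ : τ ∈ permsOn U)
    (hρ : ρ ∈ permsOn W) : τ.Disjoint ρ := by
  intro x
  by_cases hx : x ∈ U
  · exact Or.inr (hρ x (disjoint_left.1 h hx))
  · exact Or.inl (hτ x hx)

lemma cycleSum_mul [Fintype V] (c : V → ℤ) {τ ρ : Perm V} (h : τ.Disjoint ρ) {x : V}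
    (hx : ρ x = x) :
    cycleSum c (τ * ρ) x = cycleSum c τ x := by
  have (y : V) : (τ * ρ).SameCycle x y ↔ τ.SameCycle x y := by
    refine exists_congr fun k => ?_
    rw [h.commute.mul_zpow, Perm.mul_apply, Perm.zpow_apply_eq_self_of_apply_eq_self hx]
  exact Finset.sum_congr (by ext y; simp [this]) fun _ _ => rfl

lemma cycleSum_apply [Fintype V] (c : V → ℤ) (σ : Perm V) (x : V) :
    cycleSum c σ (σ x) = cycleSum c σ x :=
  Finset.sum_congr (by ext y; simp) fun _ _ => rfl

lemma apply_mem_of_mem_permsOn {S : Finset V} {σ : Perm V} (h : σ ∈ permsOn S) {x : V} :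
    σ x ∈ S ↔ x ∈ S := by
  constructor
  · intro hx
    by_contra hn
    exact hn (h x hn ▸ hx)
  · intro hx
    by_contra hn
    exact hn ((σ.injective (h _ hn)).symm ▸ hx)

/-- `U` is the union of the negative cycles. This gives permutations the same recursion that cutting
at the first minimum gives orderings. -/
lemma ncard_permsOn_eq_sum [Fintype V] [DecidableEq V] (c : V → ℤ) (S : Finset V) :
    (permsOn S).ncard =
    ∑ U ∈ S.powerset, (negPerms c U).ncard * (nonnegPerms c (S \ U)).ncard := by
  classical
  have h : (permsOn S).toFinset.card =
      (S.powerset.sigma fun U => (negPerms c U).toFinset ×ˢ (nonnegPerms c (S \ U)).toFinset).card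
      := by
    symm
    refine Finset.card_bij (fun a _ => a.2.1 * a.2.2) ?_ ?_ ?_
    · rintro ⟨U, τ, ρ⟩ h
      simp only [mem_sigma, mem_powerset, mem_product, Set.mem_toFinset] at h ⊢
      obtain ⟨hU, hτ, hρ⟩ := h
      intro x hx
      rw [Perm.mul_apply, hρ.1 x (fun hx' => hx (mem_sdiff.1 hx').1), hτ.1 x (fun h => hx (hU h))]
    · have key (U : Finset V) (τ ρ : Perm V) (hU : U ⊆ S) (hτ : τ ∈ negPerms c U)
          (hρ : ρ ∈ nonnegPerms c (S \ U)) : U = S.filter (fun x => cycleSum c (τ * ρ) x < 0) := by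
        have hd := permsOn_disjoint disjoint_sdiff hτ.1 hρ.1
        ext x
        simp only [mem_filter]
        constructor
        · intro hx
          refine ⟨hU hx, ?_⟩
          rw [cycleSum_mul c hd (hρ.1 x (by simp [hx]))]
          exact hτ.2 x hx
        · rintro ⟨hx, hx'⟩
          by_contra hn
          rw [hd.commute.eq, cycleSum_mul c hd.symm (hτ.1 x hn)] at hx'
          exact hx'.not_ge (hρ.2 x (by simp [hx, hn]))
      rintro ⟨U, τ, ρ⟩ h ⟨U', τ', ρ'⟩ h' e
      simp only [mem_sigma, mem_powerset, mem_product, Set.mem_toFinset] at h h' e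
      obtain rfl : U = U' := by
        rw [key U τ ρ h.1 h.2.1 h.2.2, key U' τ' ρ' h'.1 h'.2.1 h'.2.2, e]
      obtain rfl : τ = τ' := by
        ext x
        by_cases hx : x ∈ U
        · have := congrArg (· x) e
          simpa [h.2.2.1 x (by simp [hx]), h'.2.2.1 x (by simp [hx])] using this
        · rw [h.2.1.1 x hx, h'.2.1.1 x hx]
      obtain rfl : ρ = ρ' := mul_left_cancel e
      rfl
    · intro σ hσ
      rw [Set.mem_toFinset] at hσ
      set U := S.filter (fun x => cycleSum c σ x < 0) with hUdef
      have hU (x : V) : x ∈ U ↔ σ x ∈ U := by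
        simp [hUdef, cycleSum_apply, apply_mem_of_mem_permsOn hσ]
      set τ := Perm.ofSubtype (σ.subtypePerm (p := fun x => x ∈ U) fun x => (hU x).symm) with hτ
      have hτ1 (x : V) (hx : x ∈ U) : τ x = σ x := by
        rw [hτ, Perm.ofSubtype_apply_of_mem _ hx]; rfl
      have hτ2 (x : V) (hx : x ∉ U) : τ x = x := by
        rw [hτ, Perm.ofSubtype_apply_of_not_mem _ hx]
      have hτU : τ ∈ permsOn U := hτ2
      have hρ1 (x : V) (hx : x ∈ U) : (τ⁻¹ * σ) x = x := by
        rw [Perm.mul_apply, Perm.inv_eq_iff_eq, hτ1 x hx]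
      have hρ2 (x : V) (hx : x ∉ U) : (τ⁻¹ * σ) x = σ x := by
        rw [Perm.mul_apply, Perm.inv_eq_iff_eq, hτ2 _ (mt (hU x).2 hx)]
      have hρS : τ⁻¹ * σ ∈ permsOn (S \ U) := by
        intro x hx
        by_cases hxU : x ∈ U
        · exact hρ1 x hxU
        · rw [hρ2 x hxU]
          exact hσ x (by simpa [hxU] using hx)
      have hd := permsOn_disjoint disjoint_sdiff hτU hρS
      have hmul : τ * (τ⁻¹ * σ) = σ := mul_inv_cancel_left _ _
      refine ⟨⟨U, τ, τ⁻¹ * σ⟩, ?_, hmul⟩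
      simp only [mem_sigma, mem_powerset, mem_product, Set.mem_toFinset]
      refine ⟨filter_subset _ _, ⟨hτU, fun x hx => ?_⟩, ⟨hρS, fun x hx => ?_⟩⟩
      · rw [← cycleSum_mul c hd (hρ1 x hx), hmul]
        exact (mem_filter.1 hx).2
      · rw [← cycleSum_mul c hd.symm (hτ2 x (mem_sdiff.1 hx).2), ← hd.commute.eq, hmul]
        simp only [hUdef, mem_sdiff, mem_filter, not_and, not_lt] at hx
        exact hx.2 hx.1
  rw [Set.ncard_eq_toFinset_card', h, card_sigma]
  refine Finset.sum_congr rfl fun U _ => ?_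
  rw [card_product, Set.ncard_eq_toFinset_card', Set.ncard_eq_toFinset_card']

/-- `t` consists of one representative of each cycle inside `S`. Its nonemptiness is needed to make
a sum of negative cycle weights strictly negative. -/
lemma sum_eq_sum_cycleSum [Fintype V] (c : V → ℤ) {S : Finset V} {σ : Perm V} (h : σ ∈ permsOn S) :
    ∃ t ⊆ S, (S.Nonempty → t.Nonempty) ∧ ∑ x ∈ S, c x = ∑ x ∈ t, cycleSum c σ x := by
  classical
  let R := Perm.SameCycle.setoid σ
  have hS {x y : V} (hx : x ∈ S) (hxy : σ.SameCycle x y) : y ∈ S := by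
    by_contra hy
    have := hxy.symm.eq_of_left (h y hy)
    exact hy (this ▸ hx)
  refine ⟨(S.image (Quotient.mk R)).image Quotient.out, ?_, ?_, ?_⟩
  · simp only [subset_iff, mem_image]
    rintro _ ⟨_, ⟨x, hx, rfl⟩, rfl⟩
    exact hS hx (Perm.SameCycle.symm (Quotient.mk_out (s := R) x))
  · intro h
    exact (h.image _).image _
  · rw [Finset.sum_partition R, Finset.sum_image (fun a _ b _ h => Quotient.out_injective h)]
    refine Finset.sum_congr rfl fun q hq => ?_
    rw [cycleSum]
    refine Finset.sum_congr ?_ fun _ _ => rfl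
    obtain ⟨x, hx, rfl⟩ := mem_image.1 hq
    ext y
    have h1 : σ.SameCycle (Quotient.out (Quotient.mk R x)) x := Quotient.mk_out (s := R) x
    have h2 : Quotient.mk R y = Quotient.mk R x ↔ σ.SameCycle y x := Quotient.eq
    simp only [mem_filter, mem_univ, true_and]
    rw [h2]
    constructor
    · rintro ⟨_, h⟩
      exact h1.trans h.symm
    · intro h
      have := (h1.symm.trans h)
      exact ⟨hS hx this, this.symm⟩

/-- A form of Spitzer's lemma. -/
theorem ncard_orderings_eq_ncard_perms [Fintype V] [DecidableEq V] (c : V → ℤ) (S : Finset V) :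
    (nonnegOrderings c S).ncard = (nonnegPerms c S).ncard ∧
      (negOrderings c S).ncard = (negPerms c S).ncard := by
  induction S using Finset.strongInduction with
  | H S ih =>
  have hAe : nonnegOrderings c ∅ = {[]} := by
    ext l
    simp only [nonnegOrderings, orderings, List.toFinset_eq_empty_iff, Set.mem_ofPred_eq,
      Set.mem_singleton_iff]
    constructor
    · exact fun h => h.1.2
    · rintro rfl; simp
  have hNe : negOrderings c ∅ = {[]} := by
    ext l
    simp only [negOrderings, orderings, List.toFinset_eq_empty_iff, Set.mem_ofPred_eq,
      Set.mem_singleton_iff]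
    constructor
    · exact fun h => h.1.2
    · rintro rfl; simp
  have hP (σ : Perm V) : σ ∈ permsOn ∅ ↔ σ = 1 := by simp [permsOn, Equiv.ext_iff]
  have hBe : nonnegPerms c ∅ = {1} := by ext; simp [nonnegPerms, hP]
  have hCe : negPerms c ∅ = {1} := by ext; simp [negPerms, hP]
  rcases S.eq_empty_or_nonempty with rfl | hS
  · simp [hAe, hNe, hBe, hCe]
  -- Both recursions count `S.card.factorial` objects. The terms with `U` neither empty nor `S`
  -- agree by induction, so the two extreme terms have equal sums.
  have key : (negOrderings c S).ncard + (nonnegOrderings c S).ncard =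
      (negPerms c S).ncard + (nonnegPerms c S).ncard := by
    have h := (ncard_orderings_eq_sum c S).symm.trans
      ((ncard_orderings S).trans ((ncard_permsOn S).symm.trans (ncard_permsOn_eq_sum c S)))
    have split (F : Finset V → ℕ) : ∑ U ∈ S.powerset, F U =
        F S + (F ∅ + ∑ U ∈ (S.powerset.erase S).erase ∅, F U) := by
      rw [Finset.add_sum_erase _ _ (by simpa using hS.ne_empty.symm),
        Finset.add_sum_erase _ _ (by simp)]
    rw [split, split] at h
    have h' : ∑ U ∈ (S.powerset.erase S).erase ∅,
        (negOrderings c U).ncard * (nonnegOrderings c (S \ U)).ncard =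
        ∑ U ∈ (S.powerset.erase S).erase ∅,
        (negPerms c U).ncard * (nonnegPerms c (S \ U)).ncard := by
      refine Finset.sum_congr rfl fun U hU => ?_
      simp only [mem_erase, mem_powerset] at hU
      rw [(ih U (hU.2.2.ssubset_of_ne hU.2.1)).2,
        (ih (S \ U) (sdiff_ssubset hU.2.2 (nonempty_iff_ne_empty.2 hU.1))).1]
    rw [h'] at h
    simp only [Finset.sdiff_self, hAe, hBe, hNe, hCe, sdiff_empty, Set.ncard_singleton, mul_one,
      one_mul] at h
    omega
  -- The sign of the total weight of `S` empties the same class on both sides, which separates the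
  -- two summands of `key`.
  rcases le_or_gt 0 (∑ x ∈ S, c x) with h0 | h0
  · have h1 : negOrderings c S = ∅ := by
      refine Set.eq_empty_of_forall_notMem fun l hl => ?_
      have := hl.2 l (List.suffix_refl l) (by
        rintro rfl
        have := hl.1.2
        simp only [List.toFinset_nil] at this
        simp [← this] at hS)
      rw [sum_map_of_mem_orderings c hl.1] at this
      omega
    have h2 : negPerms c S = ∅ := by
      refine Set.eq_empty_of_forall_notMem fun σ hσ => ?_
      obtain ⟨t, htS, ht, e⟩ := sum_eq_sum_cycleSum c hσ.1
      have := Finset.sum_neg (fun x hx => hσ.2 x (htS hx)) (ht hS)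
      omega
    simp only [h1, h2, Set.ncard_empty, zero_add] at key ⊢
    exact ⟨key, trivial⟩
  · have h1 : nonnegOrderings c S = ∅ := by
      refine Set.eq_empty_of_forall_notMem fun l hl => ?_
      have := hl.2 l (List.prefix_refl l)
      rw [sum_map_of_mem_orderings c hl.1] at this
      omega
    have h2 : nonnegPerms c S = ∅ := by
      refine Set.eq_empty_of_forall_notMem fun σ hσ => ?_
      obtain ⟨t, htS, ht, e⟩ := sum_eq_sum_cycleSum c hσ.1
      have := Finset.sum_nonneg (fun x hx => hσ.2 x (htS hx))
      omega
    simp only [h1, h2, Set.ncard_empty, add_zero] at key ⊢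
    exact ⟨trivial, key⟩

end Spitzer

end DigraphParking

namespace DigraphParking

open Finset Equiv Function

/-! ### Joining the trees of a forest at their roots, and cutting them apart -/

section Gluing

variable {V : Type*}

/-- The vertices from which iteration of `f` leads to `v`. -/
noncomputable def descendants [Fintype V] (f : V → V) (v : V) : Finset V :=
  open Classical in {x | ∃ k, f^[k] x = v}

lemma mem_descendants [Fintype V] {f : V → V} {v x : V} :
    x ∈ descendants f v ↔ ∃ k, f^[k] x = v := by simp [descendants]

/-- All sets of descendants have nonnegative weight. -/
def IsGood [Fintype V] (d : V → ℤ) (f : V → V) : Prop := ∀ v, 0 ≤ ∑ x ∈ descendants f v, d x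

/-- Iteration of `g` leads every vertex to a fixed point. -/
def IsForest (g : V → V) : Prop := ∀ v, ∃ k, g (g^[k] v) = g^[k] v

/-- Iteration of `p` leads every vertex to the same fixed point. -/
def IsTree (p : V → V) : Prop := ∃ r, p r = r ∧ ∀ v, ∃ k, p^[k] v = r

/-- The fixed points of `g`. -/
noncomputable def roots [Fintype V] (g : V → V) : Finset V :=
  open Classical in {v | g v = v}

lemma mem_roots [Fintype V] {g : V → V} {v : V} : v ∈ roots g ↔ g v = v := by simp [roots]

/-- The function that is `h` on the fixed points of `g`, and `g` elsewhere. -/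
noncomputable def glue (h g : V → V) (v : V) : V := open Classical in if g v = v then h v else g v

/-- The function that fixes the elements of `P`, and is `f` elsewhere. -/
noncomputable def contract (P : Set V) (f : V → V) (v : V) : V :=
  open Classical in if v ∈ P then v else f v

lemma glue_of_fixed {h g : V → V} {v : V} (hv : g v = v) : glue h g v = h v := by
  simp [glue, hv]

lemma glue_of_not_fixed {h g : V → V} {v : V} (hv : g v ≠ v) : glue h g v = g v := by
  simp [glue, hv]

/-- Since `h` maps roots to roots, an orbit that meets a root stays among the roots; one that is
outside them at time `k` has used only `g` so far. -/
lemma iterate_glue_of_not_fixed {h g : V → V} (hh : ∀ v, g v = v → g (h v) = h v) (k : ℕ) (x : V)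
    (hx : g ((glue h g)^[k] x) ≠ (glue h g)^[k] x) : (glue h g)^[k] x = g^[k] x := by
  induction k with
  | zero => rfl
  | succ k ih =>
    rw [iterate_succ_apply'] at hx ⊢
    have h1 : g ((glue h g)^[k] x) ≠ (glue h g)^[k] x := by
      intro h1
      rw [glue_of_fixed h1] at hx
      exact hx (hh _ h1)
    rw [glue_of_not_fixed h1, ih h1, iterate_succ_apply']

lemma iterate_glue_of_iterate_not_fixed {h g : V → V} (k : ℕ) (x : V)
    (hx : g (g^[k] x) ≠ g^[k] x) : (glue h g)^[k] x = g^[k] x := by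
  induction k with
  | zero => rfl
  | succ k ih =>
    rw [iterate_succ_apply'] at hx
    have h1 : g (g^[k] x) ≠ g^[k] x := by
      intro h1
      rw [h1] at hx
      exact hx h1
    rw [iterate_succ_apply', iterate_succ_apply', ih h1, glue_of_not_fixed h1]

lemma iterate_glue_of_fixed {h g : V → V} (hh : ∀ v, g v = v → g (h v) = h v) (k : ℕ) {u : V}
    (hu : g u = u) : (glue h g)^[k] u = h^[k] u ∧ g (h^[k] u) = h^[k] u := by
  induction k with
  | zero => exact ⟨rfl, hu⟩
  | succ k ih =>
    rw [iterate_succ_apply', iterate_succ_apply', ih.1]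
    exact ⟨glue_of_fixed ih.2, hh _ ih.2⟩

lemma exists_iterate_glue_eq {h g : V → V} {u : V} (k : ℕ) (x : V)
    (hx : g^[k] x = u) : ∃ j, (glue h g)^[j] x = u := by
  induction k generalizing x with
  | zero => exact ⟨0, hx⟩
  | succ k ih =>
    by_cases h1 : g x = x
    · rw [iterate_fixed h1] at hx
      exact ⟨0, hx⟩
    · obtain ⟨j, hj⟩ := ih (g x) hx
      exact ⟨j + 1, by rw [iterate_succ_apply, glue_of_not_fixed h1, hj]⟩

lemma exists_iterate_glue_iff {h g : V → V} (hh : ∀ v, g v = v → g (h v) = h v) {v x : V}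
    (hv : g v = v) : (∃ k, (glue h g)^[k] x = v) ↔
      ∃ u, (g u = u ∧ ∃ j, h^[j] u = v) ∧ ∃ k, g^[k] x = u := by
  constructor
  · rintro ⟨k, hk⟩
    induction k generalizing x with
    | zero => exact ⟨v, ⟨hv, 0, rfl⟩, 0, hk⟩
    | succ k ih =>
      rw [iterate_succ_apply] at hk
      obtain ⟨u, ⟨hu, j, hj⟩, i, hi⟩ := ih hk
      by_cases h1 : g x = x
      · rw [glue_of_fixed h1, iterate_fixed (hh x h1)] at hi
        exact ⟨x, ⟨h1, j + 1, by rw [iterate_succ_apply, hi, hj]⟩, 0, rfl⟩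
      · rw [glue_of_not_fixed h1] at hi
        exact ⟨u, ⟨hu, j, hj⟩, i + 1, hi⟩
  · rintro ⟨u, ⟨hu, j, hj⟩, k, hk⟩
    obtain ⟨i, hi⟩ := exists_iterate_glue_eq (h := h) k x hk
    exact ⟨j + i, by rw [iterate_add_apply, hi, (iterate_glue_of_fixed hh j hu).1, hj]⟩

lemma iterate_eq_of_le {g : V → V} {x u : V} (hu : g u = u) {i j : ℕ} (hi : g^[i] x = u)
    (hij : i ≤ j) : g^[j] x = u := by
  obtain ⟨k, rfl⟩ := Nat.exists_eq_add_of_le' hij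
  rw [iterate_add_apply, hi, iterate_fixed hu]

lemma fixed_unique {g : V → V} {x u v : V} (hu : g u = u) (hv : g v = v) {i j : ℕ}
    (hi : g^[i] x = u) (hj : g^[j] x = v) : u = v := by
  rw [← iterate_eq_of_le hu hi (le_max_left i j), ← iterate_eq_of_le hv hj (le_max_right i j)]

/-- `R v` collects the roots that `h` leads to `v`. The descendants of a root `v` are the disjoint
union of the trees of these roots, while descendants of non-roots are those in `g`. Permutations and
orderings of the roots are both treated through this lemma. -/
lemma isGood_glue_iff [Fintype V] (d : V → ℤ) {h g : V → V}
    (hh : ∀ v, g v = v → g (h v) = h v) (R : V → Finset V)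
    (hR : ∀ u v, g v = v → (u ∈ R v ↔ g u = u ∧ ∃ j, h^[j] u = v)) :
    IsGood d (glue h g) ↔ (∀ v, g v ≠ v → 0 ≤ ∑ x ∈ descendants g v, d x) ∧
      ∀ v, g v = v → 0 ≤ ∑ u ∈ R v, ∑ x ∈ descendants g u, d x := by
  classical
  have h1 (v : V) (hv : g v ≠ v) : descendants (glue h g) v = descendants g v := by
    ext x
    rw [mem_descendants, mem_descendants]
    constructor
    · rintro ⟨k, rfl⟩
      exact ⟨k, (iterate_glue_of_not_fixed hh k x hv).symm⟩
    · rintro ⟨k, rfl⟩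
      exact ⟨k, iterate_glue_of_iterate_not_fixed k x hv⟩
  have h2 (v : V) (hv : g v = v) : ∑ x ∈ descendants (glue h g) v, d x =
      ∑ u ∈ R v, ∑ x ∈ descendants g u, d x := by
    rw [← Finset.sum_biUnion]
    · refine Finset.sum_congr ?_ fun _ _ => rfl
      ext x
      simp only [mem_descendants, mem_biUnion, hR _ _ hv]
      exact exists_iterate_glue_iff hh hv
    · intro u hu u' hu' hne
      rw [onFun, Finset.disjoint_left]
      intro x hx hx'
      rw [mem_descendants] at hx hx'
      obtain ⟨i, hi⟩ := hx
      obtain ⟨j, hj⟩ := hx'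
      exact hne (fixed_unique ((hR _ _ hv).1 hu).1 ((hR _ _ hv).1 hu').1 hi hj)
  constructor
  · intro H
    exact ⟨fun v hv => h1 v hv ▸ H v, fun v hv => h2 v hv ▸ H v⟩
  · rintro ⟨H1, H2⟩ v
    by_cases hv : g v = v
    · rw [h2 v hv]; exact H2 v hv
    · rw [h1 v hv]; exact H1 v hv

lemma contract_of_mem {P : Set V} {f : V → V} {v : V} (hv : v ∈ P) : contract P f v = v := by
  simp [contract, hv]

lemma contract_of_notMem {P : Set V} {f : V → V} {v : V} (hv : v ∉ P) :
    contract P f v = f v := by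
  simp [contract, hv]

lemma isForest_contract {P : Set V} {f : V → V} (h : ∀ v, ∃ k, f^[k] v ∈ P) :
    IsForest (contract P f) := by
  intro v
  obtain ⟨k, hk⟩ := h v
  induction k generalizing v with
  | zero => exact ⟨0, contract_of_mem hk⟩
  | succ k ih =>
    by_cases hv : v ∈ P
    · exact ⟨0, contract_of_mem hv⟩
    · obtain ⟨j, hj⟩ := ih (f v) hk
      refine ⟨j + 1, ?_⟩
      rw [iterate_succ_apply, contract_of_notMem hv, hj]

lemma contract_eq_self_iff {P : Set V} {f : V → V} (h : ∀ v, f v = v → v ∈ P) {v : V} :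
    contract P f v = v ↔ v ∈ P := by
  by_cases hv : v ∈ P
  · simp [contract_of_mem, hv]
  · simp only [contract_of_notMem hv, hv, iff_false]
    exact mt (h v) hv

lemma contract_glue {P : Set V} {h g : V → V} (hP : ∀ v, v ∈ P ↔ g v = v) :
    contract P (glue h g) = g := by
  ext v
  by_cases hv : v ∈ P
  · rw [contract_of_mem hv, (hP v).1 hv]
  · rw [contract_of_notMem hv, glue_of_not_fixed (mt (hP v).2 hv)]

lemma glue_contract {P : Set V} {h f : V → V} (hP : ∀ v, f v = v → v ∈ P)
    (hf : ∀ v ∈ P, h v = f v) : glue h (contract P f) = f := by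
  ext v
  by_cases hv : v ∈ P
  · rw [glue_of_fixed (contract_of_mem hv), hf v hv]
  · rw [glue_of_not_fixed (mt (contract_eq_self_iff hP).1 hv), contract_of_notMem hv]

lemma mem_periodicPts_of_fixed {f : V → V} {v : V} (h : f v = v) : v ∈ periodicPts f :=
  mk_mem_periodicPts one_pos h

lemma exists_iterate_mem_periodicPts [Finite V] (f : V → V) (v : V) :
    ∃ k, f^[k] v ∈ periodicPts f := by
  obtain ⟨i, j, hne, h⟩ := Finite.exists_ne_map_eq_of_infinite (fun k : ℕ => f^[k] v)
  wlog hij : i < j generalizing i j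
  · exact this j i hne.symm h.symm (by omega)
  refine ⟨i, mk_mem_periodicPts (n := j - i) (by omega) ?_⟩
  rw [IsPeriodicPt, IsFixedPt, ← iterate_add_apply, Nat.sub_add_cancel hij.le]
  exact h.symm

lemma IsForest.fixed_of_mem_periodicPts {g : V → V} (hg : IsForest g) {v : V}
    (hv : v ∈ periodicPts g) : g v = v := by
  obtain ⟨n, hn, h⟩ := hv
  obtain ⟨k, hk⟩ := hg v
  have h1 : g^[n * k] v = v := (h.mul_const k : _)
  have h2 := iterate_eq_of_le hk rfl (Nat.le_mul_of_pos_left k hn)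
  rw [h1] at h2
  rw [h2, hk]

end Gluing

/-! ### Functions over a fixed forest: permutations of the roots -/

section Fibers

variable {V : Type*} [Fintype V]

lemma fixed_of_permsOn {g : V → V} {σ : Perm V} (hσ : σ ∈ permsOn (roots g)) (v : V)
    (hv : g v = v) : g (σ v) = σ v := by
  rw [← mem_roots] at hv ⊢
  exact (apply_mem_of_mem_permsOn hσ).2 hv

lemma glue_perm_injOn (g : V → V) : Set.InjOn (fun σ : Perm V => glue σ g) (permsOn (roots g)) := by
  intro σ hσ τ hτ h
  ext v
  by_cases hv : v ∈ roots g
  · have := congrFun h v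
    rw [mem_roots] at hv
    simpa [glue_of_fixed hv] using this
  · rw [hσ v hv, hτ v hv]

lemma image_glue_perm {g : V → V} (hg : IsForest g) :
    (fun σ : Perm V => glue σ g) '' permsOn (roots g) =
      {f | contract (periodicPts f) f = g} := by
  classical
  ext f
  constructor
  · rintro ⟨σ, hσ, rfl⟩
    have hh := fixed_of_permsOn hσ
    refine contract_glue fun v => ⟨fun hv => ?_, fun hv => ?_⟩
    · by_contra hn
      obtain ⟨n, hn0, h⟩ := hv
      have h' : (glue σ g)^[n] v = v := h
      have := iterate_glue_of_not_fixed hh n v (by rwa [h'])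
      exact hn (hg.fixed_of_mem_periodicPts ⟨n, hn0, this.symm.trans h'⟩)
    · refine mk_mem_periodicPts (orderOf_pos σ) ?_
      change (glue σ g)^[orderOf σ] v = v
      rw [(iterate_glue_of_fixed hh _ hv).1, Perm.iterate_eq_pow, pow_orderOf_eq_one]
      rfl
  · rintro rfl
    set P := periodicPts f
    have hfix : ∀ v, f v = v → v ∈ P := fun v => mem_periodicPts_of_fixed
    have hbij := bijOn_periodicPts f
    -- The required permutation is `f` on its periodic points, which it permutes, and the identity
    -- elsewhere.
    have hinj : Injective fun v => if v ∈ P then f v else v := by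
      intro x y hxy
      simp only at hxy
      split_ifs at hxy with hx hy hy
      · exact hbij.injOn hx hy hxy
      · exact absurd (hxy ▸ hbij.mapsTo hx) hy
      · exact absurd (hxy.symm ▸ hbij.mapsTo hy) hx
      · exact hxy
    refine ⟨Equiv.ofBijective _ (Finite.injective_iff_bijective.1 hinj), ?_, ?_⟩
    · intro v hv
      rw [mem_roots, contract_eq_self_iff hfix] at hv
      simp [hv]
    · refine glue_contract hfix fun v hv => ?_
      simp [hv]

lemma sameCycle_iff_exists_iterate (σ : Perm V) (u v : V) :
    σ.SameCycle u v ↔ ∃ j, σ^[j] u = v := by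
  constructor
  · intro h
    obtain ⟨i, -, hi⟩ := h.exists_pow_eq'
    exact ⟨i, by rw [Perm.iterate_eq_pow, hi]⟩
  · rintro ⟨j, rfl⟩
    rw [Perm.iterate_eq_pow]
    exact ⟨j, by simp⟩

lemma isGood_glue_perm_iff (d : V → ℤ) {g : V → V} {σ : Perm V} (hσ : σ ∈ permsOn (roots g)) :
    IsGood d (glue σ g) ↔ (∀ v, g v ≠ v → 0 ≤ ∑ x ∈ descendants g v, d x) ∧
      σ ∈ nonnegPerms (fun u => ∑ x ∈ descendants g u, d x) (roots g) := by
  classical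
  rw [isGood_glue_iff d (fixed_of_permsOn hσ) (fun v => univ.filter fun u => σ.SameCycle v u)]
  · simp [nonnegPerms, hσ, mem_roots, cycleSum]
  · intro u v hv
    simp only [mem_filter, mem_univ, true_and]
    rw [Perm.sameCycle_comm, sameCycle_iff_exists_iterate]
    refine ⟨fun h => ⟨?_, h⟩, fun h => h.2⟩
    rw [← sameCycle_iff_exists_iterate, Perm.sameCycle_comm,
      sameCycle_iff_exists_iterate] at h
    obtain ⟨j, rfl⟩ := h
    exact (iterate_glue_of_fixed (fixed_of_permsOn hσ) j hv).2

lemma ncard_good_functions_fiber (d : V → ℤ) {g : V → V} (hg : IsForest g)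
    (hd : ∀ v, g v ≠ v → 0 ≤ ∑ x ∈ descendants g v, d x) :
    {f | IsGood d f ∧ contract (periodicPts f) f = g}.ncard =
      (nonnegPerms (fun u => ∑ x ∈ descendants g u, d x) (roots g)).ncard := by
  rw [← ((glue_perm_injOn g).mono fun σ hσ => hσ.1).ncard_image]
  congr 1
  ext f
  constructor
  · rintro ⟨h1, h2⟩
    obtain ⟨σ, hσ, rfl⟩ := (image_glue_perm hg).symm.subset h2
    exact ⟨σ, ((isGood_glue_perm_iff d hσ).1 h1).2, rfl⟩
  · rintro ⟨σ, hσ, rfl⟩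
    exact ⟨(isGood_glue_perm_iff d hσ.1).2 ⟨hd, hσ⟩,
      (image_glue_perm hg).subset ⟨σ, hσ.1, rfl⟩⟩

end Fibers

end DigraphParking

namespace DigraphParking

open Finset Equiv Function

/-! ### Marked trees over a fixed forest: orderings of the roots -/

section Lists

variable {V : Type*}

lemma headD_eq_getElem (l : List V) (h : 0 < l.length) (w₀ : V) : l.headD w₀ = l[0] := by
  cases l with
  | nil => simp at h
  | cons a l => rfl

lemma IsTree.eq_of_fixed {p : V → V} {r : V} (h : ∀ v, ∃ k, p^[k] v = r) {v : V} (hv : p v = v) :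
    v = r := by
  obtain ⟨k, hk⟩ := h v
  rw [← hk, iterate_fixed hv]

lemma forall_prefix_iff (c : V → ℤ) {l : List V} :
    (∀ u, u <+: l → 0 ≤ (u.map c).sum) ↔
      ∀ i, i < l.length → 0 ≤ ((l.take (i + 1)).map c).sum := by
  constructor
  · exact fun h i _ => h _ (List.take_prefix _ _)
  · intro h u hu
    rcases Nat.eq_zero_or_pos u.length with h0 | h0
    · simp [List.length_eq_zero_iff.1 h0]
    · have := h (u.length - 1) (by have := hu.length_le; omega)
      rwa [Nat.sub_add_cancel h0, ← List.prefix_iff_eq_take.1 hu] at this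

variable [DecidableEq V]

/-- The element after `v` in `l`, or `v` if there is none. -/
def next (l : List V) (v : V) : V := l.getD (l.idxOf v + 1) v

lemma next_getElem {l : List V} (hl : l.Nodup) (i : ℕ) (hi : i < l.length) :
    next l l[i] = l[min (i + 1) (l.length - 1)] := by
  rw [next, hl.idxOf_getElem]
  rcases Nat.lt_or_ge (i + 1) l.length with h | h
  · rw [List.getD_eq_getElem _ _ h]
    congr 1
    omega
  · rw [List.getD_eq_default _ _ h]
    congr 1
    omega

lemma next_mem {l : List V} (hl : l.Nodup) {v : V} (hv : v ∈ l) : next l v ∈ l := by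
  obtain ⟨i, hi, rfl⟩ := List.mem_iff_getElem.1 hv
  rw [next_getElem hl]
  exact List.getElem_mem _

/-- The minimum reflects that `next` fixes the last entry, which becomes the root of the tree. -/
lemma iterate_next_getElem {l : List V} (hl : l.Nodup) (i j : ℕ) (hi : i < l.length) :
    (next l)^[j] l[i] = l[min (i + j) (l.length - 1)] := by
  induction j with
  | zero => simp only [iterate_zero, id]; congr 1; omega
  | succ j ih =>
    rw [iterate_succ_apply', ih, next_getElem hl]
    congr 1
    omega

lemma exists_iterate_next_iff {l : List V} (hl : l.Nodup) (i j : ℕ) (hi : i < l.length)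
    (hj : j < l.length) : (∃ k, (next l)^[k] l[i] = l[j]) ↔ i ≤ j := by
  constructor
  · rintro ⟨k, hk⟩
    rw [iterate_next_getElem hl, hl.getElem_inj_iff] at hk
    omega
  · intro h
    refine ⟨j - i, ?_⟩
    rw [iterate_next_getElem hl]
    congr 1
    omega

end Lists

section TreeFibers

variable {V : Type*} [Fintype V] [DecidableEq V]

/-- The vertices on the path from `w` to the root. -/
def spine (p : V → V) (w : V) : Set V := {v | ∃ k, p^[k] w = v}

lemma mem_iff_of_mem_orderings {g : V → V} {l : List V} (hl : l ∈ orderings (roots g)) {v : V} :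
    v ∈ l ↔ g v = v := by
  rw [← mem_roots, ← hl.2, List.mem_toFinset]

lemma fixed_of_orderings {g : V → V} {l : List V} (hl : l ∈ orderings (roots g)) (v : V)
    (hv : g v = v) : g (next l v) = next l v := by
  rw [← mem_iff_of_mem_orderings hl] at hv ⊢
  exact next_mem hl.1 hv

lemma length_pos_of_mem_orderings {g : V → V} (hg : IsForest g) {l : List V}
    (hl : l ∈ orderings (roots g)) (w₀ : V) : 0 < l.length := by
  obtain ⟨k, hk⟩ := hg w₀
  exact List.length_pos_of_mem ((mem_iff_of_mem_orderings hl).2 hk)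

lemma iterate_glue_next {g : V → V} {l : List V} (hl : l ∈ orderings (roots g)) (i j : ℕ)
    (hi : i < l.length) : (glue (next l) g)^[j] l[i] = l[min (i + j) (l.length - 1)] := by
  rw [(iterate_glue_of_fixed (fixed_of_orderings hl) j
    ((mem_iff_of_mem_orderings hl).1 (List.getElem_mem hi))).1, iterate_next_getElem hl.1]

/-- The walk from the head of `l` runs through all of `l`. The default `w₀` plays no role, as a
forest on a nonempty type has a root. -/
lemma mem_spine_glue_next_iff {g : V → V} (hg : IsForest g) {l : List V}
    (hl : l ∈ orderings (roots g)) (w₀ v : V) :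
    v ∈ spine (glue (next l) g) (l.headD w₀) ↔ g v = v := by
  have h0 := length_pos_of_mem_orderings hg hl w₀
  rw [headD_eq_getElem l h0, ← mem_iff_of_mem_orderings hl]
  constructor
  · rintro ⟨k, rfl⟩
    rw [iterate_glue_next hl]
    exact List.getElem_mem _
  · intro hv
    obtain ⟨i, hi, rfl⟩ := List.mem_iff_getElem.1 hv
    refine ⟨i, ?_⟩
    rw [iterate_glue_next hl]
    congr 1
    omega

lemma isTree_glue_next {g : V → V} (hg : IsForest g) {l : List V}
    (hl : l ∈ orderings (roots g)) (w₀ : V) : IsTree (glue (next l) g) := by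
  have h0 := length_pos_of_mem_orderings hg hl w₀
  refine ⟨l[l.length - 1], ?_, fun v => ?_⟩
  · have := iterate_glue_next hl (l.length - 1) 1 (by omega)
    rw [iterate_one] at this
    rw [this]
    congr 1
    omega
  · obtain ⟨k, hk⟩ := hg v
    obtain ⟨i, hi⟩ := exists_iterate_glue_eq (h := next l) k v rfl
    obtain ⟨a, ha, e⟩ := List.mem_iff_getElem.1 ((mem_iff_of_mem_orderings hl).2 hk)
    refine ⟨l.length + i, ?_⟩
    rw [iterate_add_apply, hi, ← e, iterate_glue_next hl]
    congr 1
    omega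

/-- The ordering is read off as the first iterates of the marked vertex, as many as there are roots.
-/
lemma glue_next_injOn {g : V → V} (hg : IsForest g) (w₀ : V) :
    Set.InjOn (fun l => (glue (next l) g, l.headD w₀)) (orderings (roots g)) := by
  have key (l : List V) (hl : l ∈ orderings (roots g)) :
      l = (List.range (roots g).card).map fun j => (glue (next l) g)^[j] (l.headD w₀) := by
    have h0 := length_pos_of_mem_orderings hg hl w₀
    have hlen : l.length = (roots g).card := by
      rw [← hl.2, List.toFinset_card_of_nodup hl.1]
    refine List.ext_getElem (by simp [hlen]) fun i hi _ => ?_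
    rw [List.getElem_map, List.getElem_range, headD_eq_getElem l h0, iterate_glue_next hl]
    congr 1
    omega
  intro l hl l' hl' h
  simp only [Prod.mk.injEq] at h
  rw [key l hl, key l' hl', h.1, h.2]

lemma image_glue_next {g : V → V} (hg : IsForest g) (w₀ : V) :
    (fun l => (glue (next l) g, l.headD w₀)) '' orderings (roots g) =
      {a | IsTree a.1 ∧ contract (spine a.1 a.2) a.1 = g} := by
  classical
  ext ⟨p, w⟩
  constructor
  · rintro ⟨l, hl, e⟩
    obtain ⟨rfl, rfl⟩ := Prod.mk.inj e
    exact ⟨isTree_glue_next hg hl w₀, contract_glue (mem_spine_glue_next_iff hg hl w₀)⟩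
  · rintro ⟨⟨r, hr, hp⟩, rfl⟩
    simp only
    have hfix : ∀ v, p v = v → v ∈ spine p w := by
      intro v hv
      rw [IsTree.eq_of_fixed hp hv]
      exact hp w
    set N := Nat.find (hp w) with hN
    have hNr : p^[N] w = r := Nat.find_spec (hp w)
    have hNlt {i : ℕ} (hi : i < N) : p^[i] w ≠ r := Nat.find_min (hp w) hi
    set l := (List.range (N + 1)).map fun i => p^[i] w with hldef
    have hget (i : ℕ) (hi : i < l.length) : l[i] = p^[i] w := by
      simp only [hldef, List.getElem_map, List.getElem_range]
    have hlen : l.length = N + 1 := by simp [hldef]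
    have hnd : l.Nodup := by
      rw [hldef, List.nodup_map_iff_inj_on List.nodup_range]
      intro i hi j hj hij
      rw [List.mem_range] at hi hj
      wlog h : i < j generalizing i j
      · by_contra hne
        exact hne (this j hj i hi hij.symm (by omega)).symm
      exfalso
      -- A repetition at times `i < j` would shorten the path by `j - i` steps, against the
      -- minimality of `N`.
      refine hNlt (i := N - j + i) (by omega) ?_
      rw [iterate_add_apply, hij, ← iterate_add_apply, Nat.sub_add_cancel (by omega), hNr]
    have hmem (v : V) : v ∈ l ↔ v ∈ spine p w := by
      simp only [hldef, List.mem_map, List.mem_range, spine, Set.mem_ofPred_eq]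
      constructor
      · rintro ⟨i, -, h⟩
        exact ⟨i, h⟩
      · rintro ⟨i, h⟩
        rcases Nat.lt_or_ge i (N + 1) with hi | hi
        · exact ⟨i, hi, h⟩
        · exact ⟨N, by omega, by rw [hNr, ← h, iterate_eq_of_le hr hNr (by omega)]⟩
    refine ⟨l, ⟨hnd, ?_⟩, Prod.ext (glue_contract hfix fun v hv => ?_) ?_⟩
    · ext v
      rw [List.mem_toFinset, hmem, mem_roots, contract_eq_self_iff hfix]
    · obtain ⟨i, hi, rfl⟩ := List.mem_iff_getElem.1 ((hmem v).2 hv)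
      rw [next_getElem hnd, hget, hget, ← iterate_succ_apply' p]
      rcases Nat.lt_or_ge (i + 1) l.length with h | h
      · congr 2
        omega
      · rw [iterate_eq_of_le hr hNr (by omega), iterate_eq_of_le hr hNr (by omega)]
    · exact (headD_eq_getElem l (by omega) w₀).trans (hget _ _)

/-- The roots whose walk reaches `v` are those up to and including `v` in `l`, so the condition at
`v` concerns the prefix ending there. -/
lemma isGood_glue_next_iff (d : V → ℤ) {g : V → V} {l : List V}
    (hl : l ∈ orderings (roots g)) :
    IsGood d (glue (next l) g) ↔ (∀ v, g v ≠ v → 0 ≤ ∑ x ∈ descendants g v, d x) ∧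
      l ∈ nonnegOrderings (fun u => ∑ x ∈ descendants g u, d x) (roots g) := by
  classical
  rw [isGood_glue_iff d (fixed_of_orderings hl)
    (fun v => (l.take (l.idxOf v + 1)).toFinset)]
  · refine and_congr_right fun _ => ?_
    have (c : V → ℤ) (i : ℕ) (hi : i < l.length) :
        ∑ u ∈ (l.take (l.idxOf l[i] + 1)).toFinset, c u = ((l.take (i + 1)).map c).sum := by
      rw [List.sum_toFinset _ (hl.1.sublist (List.take_sublist _ _)), hl.1.idxOf_getElem]
    simp only [nonnegOrderings, Set.mem_ofPred_eq, hl, true_and, forall_prefix_iff]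
    constructor
    · intro h i hi
      rw [← this _ i hi]
      exact h _ ((mem_iff_of_mem_orderings hl).1 (List.getElem_mem hi))
    · intro h v hv
      obtain ⟨i, hi, rfl⟩ := List.mem_iff_getElem.1 ((mem_iff_of_mem_orderings hl).2 hv)
      rw [this _ i hi]
      exact h i hi
  · intro u v hv
    obtain ⟨j, hj, rfl⟩ := List.mem_iff_getElem.1 ((mem_iff_of_mem_orderings hl).2 hv)
    rw [← mem_iff_of_mem_orderings hl, List.mem_toFinset, hl.1.idxOf_getElem,
      List.mem_take_iff_getElem]
    constructor
    · rintro ⟨i, hi, rfl⟩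
      exact ⟨List.getElem_mem _, (exists_iterate_next_iff hl.1 _ _ _ _).2 (by omega)⟩
    · rintro ⟨hu, h⟩
      obtain ⟨i, hi, rfl⟩ := List.mem_iff_getElem.1 hu
      rw [exists_iterate_next_iff hl.1] at h
      exact ⟨i, by omega, rfl⟩

lemma ncard_good_trees_fiber [Nonempty V] (d : V → ℤ) {g : V → V} (hg : IsForest g)
    (hd : ∀ v, g v ≠ v → 0 ≤ ∑ x ∈ descendants g v, d x) :
    {a : (V → V) × V | (IsTree a.1 ∧ IsGood d a.1) ∧ contract (spine a.1 a.2) a.1 = g}.ncard =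
      (nonnegOrderings (fun u => ∑ x ∈ descendants g u, d x) (roots g)).ncard := by
  obtain ⟨w₀⟩ := ‹Nonempty V›
  rw [← ((glue_next_injOn hg w₀).mono fun l hl => hl.1).ncard_image]
  congr 1
  ext a
  constructor
  · rintro ⟨⟨h1, h2⟩, h3⟩
    obtain ⟨l, hl, rfl⟩ := (image_glue_next hg w₀).symm.subset ⟨h1, h3⟩
    exact ⟨l, ((isGood_glue_next_iff d hl).1 h2).2, rfl⟩
  · rintro ⟨l, hl, rfl⟩
    have := (image_glue_next hg w₀).subset ⟨l, hl.1, rfl⟩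
    exact ⟨⟨this.1, (isGood_glue_next_iff d hl.1).2 ⟨hd, hl⟩⟩, this.2⟩

lemma ncard_setOf_eq_zero {α : Type*} {P : α → Prop} (h : ∀ a, ¬ P a) : {a | P a}.ncard = 0 := by
  simp [h]

lemma ncard_eq_sum_fibers {α β : Type*} [Finite α] [Fintype β] (P : α → Prop) (φ : α → β) :
    {a | P a}.ncard = ∑ b, {a | P a ∧ φ a = b}.ncard := by
  classical
  cases nonempty_fintype α
  simp only [Set.ncard_eq_toFinset_card', Set.toFinset_ofPred]
  rw [Finset.card_eq_sum_card_fiberwise (f := φ) (t := univ) (by simp)]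
  simp only [filter_filter]

/-- Trees with a marked vertex and functions, both with nonnegative weights of all sets of
descendants, are equinumerous. -/
theorem card_mul_ncard_good_trees [Nonempty V] (d : V → ℤ) :
    Fintype.card V * {p : V → V | IsTree p ∧ IsGood d p}.ncard =
      {f : V → V | IsGood d f}.ncard := by
  -- The cardinality becomes the choice of a marked vertex, which need not be related to the tree.
  have h1 : Fintype.card V * {p : V → V | IsTree p ∧ IsGood d p}.ncard =
      {a : (V → V) × V | IsTree a.1 ∧ IsGood d a.1}.ncard := by
    rw [mul_comm, ← Nat.card_eq_fintype_card, ← Set.ncard_univ, ← Set.ncard_prod]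
    congr 1
    ext
    simp
  rw [h1, ncard_eq_sum_fibers _ (fun a : (V → V) × V => contract (spine a.1 a.2) a.1),
    ncard_eq_sum_fibers _ (fun f : V → V => contract (periodicPts f) f)]
  refine Finset.sum_congr rfl fun g _ => ?_
  by_cases hg : IsForest g
  · by_cases hd : ∀ v, g v ≠ v → 0 ≤ ∑ x ∈ descendants g v, d x
    · rw [ncard_good_trees_fiber d hg hd, ncard_good_functions_fiber d hg hd,
        (ncard_orderings_eq_ncard_perms _ _).1]
    · obtain ⟨w₀⟩ := ‹Nonempty V›
      refine (ncard_setOf_eq_zero ?_).trans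
        (ncard_setOf_eq_zero ?_).symm
      · rintro a ⟨⟨h1, h2⟩, h3⟩
        obtain ⟨l, hl, rfl⟩ := (image_glue_next hg w₀).symm.subset ⟨h1, h3⟩
        exact hd ((isGood_glue_next_iff d hl).1 h2).1
      · rintro f ⟨h1, h2⟩
        obtain ⟨σ, hσ, rfl⟩ := (image_glue_perm hg).symm.subset h2
        exact hd ((isGood_glue_perm_iff d hσ).1 h1).1
  -- If `g` is not a forest both fibers are empty, because either way of cutting produces a forest.
  · refine (ncard_setOf_eq_zero ?_).trans
      (ncard_setOf_eq_zero ?_).symm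
    · rintro ⟨p, w⟩ ⟨⟨⟨r, hr, hp⟩, -⟩, rfl⟩
      refine hg (isForest_contract fun v => ?_)
      obtain ⟨k, hk⟩ := hp v
      exact ⟨k, hk ▸ hp w⟩
    · rintro f ⟨-, rfl⟩
      exact hg (isForest_contract (exists_iterate_mem_periodicPts f))

end TreeFibers

end DigraphParking

namespace DigraphParking

open Finset Function Relation

/-! ### Parking as a matching problem, and Hall's condition -/

section Parking

variable {V : Type*} {D : Digraph V}

lemma ParksAt.notMem {occ : Set V} {v x : V} (h : ParksAt D occ v x) : x ∉ occ := by
  induction h with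
  | park hv => exact hv
  | drive _ _ _ ih => exact ih

lemma ParksAt.reflTransGen {occ : Set V} {v x : V} (h : ParksAt D occ v x) :
    ReflTransGen D.Adj v x := by
  induction h with
  | park _ => exact ReflTransGen.refl
  | drive _ hvw _ ih => exact ReflTransGen.head hvw ih

lemma exists_parksAt {occ : Set V} {v x : V} (h : ReflTransGen D.Adj v x) (hx : x ∉ occ) :
    ∃ y, ParksAt D occ v y ∧ ReflTransGen D.Adj y x := by
  induction h using ReflTransGen.head_induction_on with
  | refl => exact ⟨x, .park hx, .refl⟩
  | @head v w hvw hwx ih =>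
    by_cases hv : v ∈ occ
    · obtain ⟨y, hy, hyx⟩ := ih
      exact ⟨y, .drive hv hvw hy, hyx⟩
    · exact ⟨v, .park hv, .head hvw hwx⟩

/-- Drivers can park if and only if they can be assigned distinct vertices within their reach. -/
lemma isParkingFunction_iff_exists_injective {m : ℕ} (s : Fin m → V) :
    IsParkingFunction D s ↔
      ∃ q : Fin m → V, Injective q ∧ ∀ i, ReflTransGen D.Adj (s i) (q i) := by
  constructor
  · rintro ⟨p, hp⟩
    have key (i j : Fin m) (h : j < i) : p j ≠ p i := fun e => (hp i).notMem ⟨j, h, e⟩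
    refine ⟨p, fun i j hij => ?_, fun i => (hp i).reflTransGen⟩
    by_contra hne
    rcases lt_or_gt_of_ne hne with h | h
    · exact key j i h hij
    · exact key i j h hij.symm
  · rintro ⟨q, hq, hr⟩
    -- Exchange argument: the assignment is corrected driver by driver until the first `k` drivers
    -- park by the rules.
    suffices H : ∀ k ≤ m, ∃ q : Fin m → V, Injective q ∧
        (∀ i, ReflTransGen D.Adj (s i) (q i)) ∧
        ∀ i : Fin m, i.1 < k → ParksAt D {x | ∃ j : Fin m, j < i ∧ q j = x} (s i) (q i) by
      obtain ⟨p, -, -, hp⟩ := H m le_rfl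
      exact ⟨p, fun i => hp i i.2⟩
    intro k
    induction k with
    | zero => exact fun _ => ⟨q, hq, hr, fun i hi => absurd hi (Nat.not_lt_zero _)⟩
    | succ k ih =>
      intro hk
      obtain ⟨q, hq, hr, hp⟩ := ih (by omega)
      set a : Fin m := ⟨k, hk⟩ with ha
      obtain ⟨y, hy, hyx⟩ := exists_parksAt (occ := {x | ∃ j : Fin m, j < a ∧ q j = x}) (hr a) (by
        rintro ⟨j, hj, e⟩
        exact hj.ne (hq e))
      suffices H : ∃ q' : Fin m → V, Injective q' ∧ (∀ i, ReflTransGen D.Adj (s i) (q' i)) ∧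
          (∀ i < a, q' i = q i) ∧ q' a = y by
        obtain ⟨q', hq', hr', hlt, heq⟩ := H
        refine ⟨q', hq', hr', fun i hi => ?_⟩
        have hocc : ∀ i ≤ a, {x | ∃ j : Fin m, j < i ∧ q' j = x} =
            {x | ∃ j : Fin m, j < i ∧ q j = x} := by
          intro i hi
          ext x
          refine exists_congr fun j => and_congr_right fun hj => ?_
          rw [hlt j (hj.trans_le hi)]
        rcases Nat.lt_succ_iff_lt_or_eq.1 hi with h | h
        · have : i < a := h
          rw [hocc i this.le, hlt i this]
          exact hp i h
        · obtain rfl : i = a := Fin.ext h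
          rw [hocc a le_rfl, heq]
          exact hy
      by_cases hyq : ∃ j, q j = y
      · obtain ⟨j, rfl⟩ := hyq
        have haj : a ≤ j := by
          by_contra hlt
          exact hy.notMem ⟨j, not_le.1 hlt, rfl⟩
        -- Driver `j`, who loses `y` to driver `a`, takes over `q a`, which she can reach by way of
        -- `y`.
        refine ⟨q ∘ Equiv.swap a j, hq.comp (Equiv.injective _), fun i => ?_, fun i hi => ?_, ?_⟩
        · rw [comp_apply]
          by_cases hia : i = a
          · subst hia
            rw [Equiv.swap_apply_left]
            exact hy.reflTransGen
          by_cases hij : i = j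
          · subst hij
            rw [Equiv.swap_apply_right]
            exact (hr i).trans hyx
          · rw [Equiv.swap_apply_of_ne_of_ne hia hij]
            exact hr i
        · rw [comp_apply, Equiv.swap_apply_of_ne_of_ne hi.ne (hi.trans_le haj).ne]
        · simp
      · refine ⟨update q a y, fun i j hij => ?_, fun i => ?_, fun i hi => ?_, by simp⟩
        · by_cases hia : i = a <;> by_cases hja : j = a
          · rw [hia, hja]
          · rw [hia, update_self, update_of_ne hja] at hij
            exact absurd ⟨j, hij.symm⟩ hyq
          · rw [hja, update_self, update_of_ne hia] at hij
            exact absurd ⟨i, hij⟩ hyq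
          · rw [update_of_ne hia, update_of_ne hja] at hij
            exact hq hij
        · by_cases hia : i = a
          · subst hia
            rw [update_self]
            exact hy.reflTransGen
          · rw [update_of_ne hia]
            exact hr i
        · rw [update_of_ne hi.ne]

/-- Every edge of `D` that ends in `v` starts in `f v`, and there is one if `f v ≠ v`. -/
def IsParentMap (D : Digraph V) (f : V → V) : Prop :=
  (∀ u v, D.Adj u v → u = f v) ∧ ∀ v, f v ≠ v → D.Adj (f v) v

variable {f : V → V}

/-- Loops do not affect reachability, so the root of a tree may be its own parent under `f` without
having a loop in `D`. -/
lemma IsParentMap.reflTransGen_iff (h : IsParentMap D f) {v x : V} :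
    ReflTransGen D.Adj v x ↔ ∃ k, f^[k] x = v := by
  constructor
  · intro H
    induction H with
    | refl => exact ⟨0, rfl⟩
    | tail _ hbc ih =>
      obtain ⟨k, hk⟩ := ih
      exact ⟨k + 1, by rw [iterate_succ_apply, ← h.1 _ _ hbc, hk]⟩
  · rintro ⟨k, rfl⟩
    induction k with
    | zero => exact .refl
    | succ k ih =>
      rw [iterate_succ_apply']
      by_cases hk : f (f^[k] x) = f^[k] x
      · rwa [hk]
      · exact .head (h.2 _ hk) ih

/-- Reversed edges form a partial function, so the ancestors of a vertex are a chain. -/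
lemma IsParentMap.total (h : IsParentMap D f) {u v x : V} (hu : ReflTransGen D.Adj u x)
    (hv : ReflTransGen D.Adj v x) : ReflTransGen D.Adj u v ∨ ReflTransGen D.Adj v u := by
  have := ReflTransGen.total_of_right_unique (r := swap D.Adj)
    (fun a b c hab hac => (h.1 _ _ hab).trans (h.1 _ _ hac).symm)
    (reflTransGen_swap.2 hu) (reflTransGen_swap.2 hv)
  exact this.symm.imp reflTransGen_swap.1 reflTransGen_swap.1

/-- A set closed under reachability is a disjoint union of sets of descendants; these are removed
one at a time, a largest one first. -/
lemma sum_nonneg_of_isGood [Fintype V] (h : IsParentMap D f) {d : V → ℤ} (hd : IsGood d f)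
    (W : Finset V) (hW : ∀ x ∈ W, ∀ y, ReflTransGen D.Adj x y → y ∈ W) : 0 ≤ ∑ x ∈ W, d x := by
  classical
  have hmem {v x : V} : x ∈ descendants f v ↔ ReflTransGen D.Adj v x := by
    rw [mem_descendants, h.reflTransGen_iff]
  induction W using Finset.strongInduction with
  | H W ih =>
  rcases W.eq_empty_or_nonempty with rfl | hne
  · simp
  obtain ⟨v, hv, hmax⟩ := exists_max_image W (fun v => (descendants f v).card) hne
  have hsub : descendants f v ⊆ W := fun x hx => hW v hv x (hmem.1 hx)
  rw [← Finset.sum_sdiff hsub]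
  refine add_nonneg (ih _ (sdiff_ssubset hsub ⟨v, hmem.2 .refl⟩) fun x hx y hxy => ?_) (hd v)
  rw [mem_sdiff] at hx ⊢
  refine ⟨hW x hx.1 y hxy, fun hy => ?_⟩
  -- A remaining `x` with a successor among the descendants of `v` would lie above `v`,
  -- contradicting the maximality of `v`, or below it, where it has been removed.
  rcases h.total hxy (hmem.1 hy) with hxv | hvx
  · have hle : descendants f v ⊆ descendants f x := fun z hz => hmem.2 (hxv.trans (hmem.1 hz))
    have := eq_of_subset_of_card_le hle (hmax x hx.1)
    exact hx.2 (this ▸ hmem.2 .refl)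
  · exact hx.2 (hmem.2 hvx)

/-- The weight of a vertex: one minus the number of drivers who start there. -/
noncomputable def excess {m : ℕ} (s : Fin m → V) (x : V) : ℤ :=
  open Classical in 1 - (#{i | s i = x} : ℤ)

lemma sum_excess {m : ℕ} (s : Fin m → V) (W : Finset V) [DecidableEq V] :
    ∑ x ∈ W, excess s x = (#W : ℤ) - #{i | s i ∈ W} := by
  classical
  have h : #{i | s i ∈ W} = ∑ x ∈ W, #{i | s i = x} := by
    rw [Finset.card_eq_sum_card_fiberwise (f := s) (t := W) (by intro i hi; simpa using hi)]
    refine Finset.sum_congr rfl fun x hx => ?_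
    congr 1
    ext i
    simp only [mem_filter, mem_univ, true_and, and_iff_right_iff_imp]
    rintro rfl
    exact hx
  simp only [excess, Finset.sum_sub_distrib, h]
  push_cast
  simp
  exact Finset.sum_congr rfl fun x _ => by congr

/-- Hall's condition for a set of drivers concerns the union of their reachable sets. That union is
closed, so `sum_nonneg_of_isGood` reduces it to single sets of descendants. -/
lemma isParkingFunction_iff_isGood [Fintype V] (h : IsParentMap D f) {m : ℕ} (s : Fin m → V) :
    IsParkingFunction D s ↔ IsGood (excess s) f := by
  classical
  have hmem {v x : V} : x ∈ descendants f v ↔ ReflTransGen D.Adj v x := by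
    rw [mem_descendants, h.reflTransGen_iff]
  simp only [isParkingFunction_iff_exists_injective, ← hmem]
  rw [← Finset.all_card_le_biUnion_card_iff_exists_injective]
  constructor
  · intro H v
    have h1 := H {i | s i ∈ descendants f v}
    have h2 : (Finset.biUnion {i | s i ∈ descendants f v} fun i => descendants f (s i)) ⊆
        descendants f v := by
      intro x hx
      simp only [mem_biUnion, mem_filter, mem_univ, true_and] at hx
      obtain ⟨i, hi, hx⟩ := hx
      exact hmem.2 ((hmem.1 hi).trans (hmem.1 hx))
    have h3 := h1.trans (card_le_card h2)
    rw [sum_excess]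
    omega
  · intro H A
    have h1 := sum_nonneg_of_isGood h H (A.biUnion fun i => descendants f (s i)) (by
      intro x hx y hxy
      simp only [mem_biUnion] at hx ⊢
      obtain ⟨i, hi, hx⟩ := hx
      exact ⟨i, hi, hmem.2 ((hmem.1 hx).trans hxy)⟩)
    rw [sum_excess] at h1
    have h2 : A ⊆ univ.filter fun i => s i ∈ A.biUnion fun i => descendants f (s i) := by
      intro i hi
      simp only [mem_filter, mem_univ, true_and, mem_biUnion]
      exact ⟨i, hi, hmem.2 .refl⟩
    have h3 := card_le_card h2
    omega

end Parking

/-! ### Encoding both families of digraphs by parent maps -/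

section Digraphs

variable {V : Type*}

lemma isParentMap_inverseMappingDigraph (f : V → V) :
    IsParentMap (inverseMappingDigraph f) f :=
  ⟨fun _ _ h => h, fun _ _ => rfl⟩

lemma inverseMappingDigraph_injective :
    Injective (inverseMappingDigraph : (V → V) → Digraph V) := by
  intro f g h
  ext v
  have h1 : (inverseMappingDigraph g).Adj (f v) v := h ▸ rfl
  exact h1

/-- The digraph with an edge from `p v` to `v` whenever these vertices are distinct. -/
def parentDigraph (p : V → V) : Digraph V where
  Adj u v := u = p v ∧ p v ≠ v

lemma isParentMap_parentDigraph (p : V → V) : IsParentMap (parentDigraph p) p :=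
  ⟨fun _ _ h => h.1, fun _ h => ⟨rfl, h⟩⟩

lemma parentDigraph_injective : Injective (parentDigraph : (V → V) → Digraph V) := by
  intro p q h
  ext v
  by_cases hp : p v = v
  · by_cases hq : q v = v
    · rw [hp, hq]
    · have h1 : (parentDigraph p).Adj (q v) v := h ▸ ⟨rfl, hq⟩
      exact h1.1.symm
  · have h1 : (parentDigraph q).Adj (p v) v := h ▸ ⟨rfl, hp⟩
    exact h1.1

lemma isSourceTree_iff (D : Digraph V) :
    IsSourceTree D ↔ ∃ p, IsTree p ∧ parentDigraph p = D := by
  classical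
  constructor
  · rintro ⟨r, hr, hu, hreach⟩
    choose! par hpar hpar' using hu
    set p : V → V := fun v => if v = r then r else par v with hp
    -- A loop at `v` would be its only incoming edge, leaving `v` unreachable from the root.
    have hne (v : V) (hv : v ≠ r) : par v ≠ v := by
      intro e
      have (x : V) (hx : ReflTransGen D.Adj r x) : x ≠ v := by
        induction hx with
        | refl => exact hv.symm
        | tail _ hbc ih =>
          rintro rfl
          exact ih ((hpar' _ hv _ hbc).trans e)
      exact this v (hreach v) rfl
    have hD : parentDigraph p = D := by
      ext u v
      change u = p v ∧ p v ≠ v ↔ _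
      by_cases hv : v = r
      · subst hv
        simp [hp, hr]
      · simp only [hp, hv, if_false]
        exact ⟨fun h => h.1 ▸ hpar v hv, fun h => ⟨hpar' v hv u h, hne v hv⟩⟩
    refine ⟨p, ⟨r, by simp [hp], fun v => ?_⟩, hD⟩
    rw [← (isParentMap_parentDigraph p).reflTransGen_iff, hD]
    exact hreach v
  · rintro ⟨p, ⟨r, hr, hp⟩, rfl⟩
    refine ⟨r, fun u h => h.2 hr, fun v hv => ⟨p v, ⟨rfl, ?_⟩, fun u h => h.1⟩, fun v => ?_⟩
    · exact fun h => hv (IsTree.eq_of_fixed hp h)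
    · exact (isParentMap_parentDigraph p).reflTransGen_iff.2 (hp v)

lemma numParking_eq {n m : ℕ} {D : Digraph (Fin n)} {f : Fin n → Fin n} (h : IsParentMap D f) :
    open Classical in numParking D m = #{s : Fin m → Fin n | IsGood (excess s) f} := by
  classical
  rw [numParking, Nat.card_eq_fintype_card, Fintype.card_subtype]
  congr 1
  ext s
  simp [isParkingFunction_iff_isGood h]

lemma sourceTreeTotal_eq (n m : ℕ) : sourceTreeTotal n m =
    ∑ s : Fin m → Fin n, {p | IsTree p ∧ IsGood (excess s) p}.ncard := by
  classical
  have h : (univ.filter fun D : Digraph (Fin n) => D ∈ sourceTrees n) =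
      (univ.filter IsTree).image parentDigraph := by
    ext D
    simp [sourceTrees, isSourceTree_iff]
  rw [sourceTreeTotal, h, Finset.sum_image (parentDigraph_injective.injOn)]
  simp only [numParking_eq (isParentMap_parentDigraph _)]
  -- Double counting of pairs moves the sum from trees to sequences `s`, where the weight is fixed.
  have := Finset.sum_card_bipartiteAbove_eq_sum_card_bipartiteBelow
    (s := univ.filter fun p : Fin n → Fin n => IsTree p) (t := univ)
    (fun p (s : Fin m → Fin n) => IsGood (excess s) p)
  simp only [bipartiteAbove, bipartiteBelow, filter_filter] at this
  simp only [Set.ncard_eq_toFinset_card', Set.toFinset_ofPred]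
  convert this

lemma inverseMappingTotal_eq (n m : ℕ) : inverseMappingTotal n m =
    ∑ s : Fin m → Fin n, {f | IsGood (excess s) f}.ncard := by
  classical
  have h : (univ.filter fun D : Digraph (Fin n) => D ∈ inverseMappings n) =
      univ.image inverseMappingDigraph := by
    ext D
    simp [inverseMappings]
  rw [inverseMappingTotal, h, Finset.sum_image (inverseMappingDigraph_injective.injOn)]
  simp only [numParking_eq (isParentMap_inverseMappingDigraph _)]
  have := Finset.sum_card_bipartiteAbove_eq_sum_card_bipartiteBelow
    (s := (univ : Finset (Fin n → Fin n))) (t := univ)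
    (fun p (s : Fin m → Fin n) => IsGood (excess s) p)
  simp only [bipartiteAbove, bipartiteBelow] at this
  simp only [Set.ncard_eq_toFinset_card', Set.toFinset_ofPred]
  convert this

end Digraphs

end DigraphParking

theorem mainTheorem1 (n m : ℕ) (hn : 1 ≤ n) (hm : m ≤ n) :
    n * DigraphParking.sourceTreeTotal n m = DigraphParking.inverseMappingTotal n m := by
  have : Nonempty (Fin n) := ⟨⟨0, hn⟩⟩
  rw [DigraphParking.sourceTreeTotal_eq, DigraphParking.inverseMappingTotal_eq, Finset.mul_sum]
  refine Finset.sum_congr rfl fun s _ => ?_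
  simpa using DigraphParking.card_mul_ncard_good_trees (DigraphParking.excess s)
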